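/- Let $m\ge 2$, let $0<\gamma_1,\dots,\gamma_m<1$, and let $f,g:(0,\infty)\to\mathbb{R}$ satisfy $$f(x)=\sum_{i=1}^m f(\gamma_i^2x)+g(x)\qquad(x>0),$$ where $g$ is bounded on $(0,\infty)$ and $f$ is bounded on $(0,x_0)$ for some $x_0>0$ (for instance, $f$ vanishes there). Then the equation $\sum_{i=1}^m\gamma_i^{d}=1$ has a unique positive solution $d=d_S$, and the following assertions hold. 1. (Arithmetic, or lattice, case.) If the additive subgroup of $\mathbb{R}$ generated by $\log\gamma_1,\dots,\log\gamma_m$ is discrete, generated by $T>0$ (that is, equal to $T\mathbb{Z}$), then there is a periodic function $G:\mathbb{R}\to\mathbb{R}$ of period $T$ such that $$f(x)=x^{d_S/2}\Bigl(G\bigl(\tfrac{\log x}{2}\bigr)+o(1)\Bigr)\qquad(x\to\infty).$$ 2. (Non-arithmetic, or non-lattice, case.) If the additive subgroup of $\mathbb{R}$ generated by $\log\gamma_1,\dots,\log\gamma_m$ is dense in $\mathbb{R}$, and $f$ is continuous at Lebesgue-almost every point of $(0,\infty)$ (for instance, $f$ is monotone), then the limit $$\lim_{x\to\infty}f(x)\,x^{-d_S/2}$$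 exists as a real number. -/

import Mathlib

open Filter Topology MeasureTheory

/-! With `h t = exp (-d t) * f (exp (2 t))`, `p i = γ i ^ d` and `τ i = -log (γ i)`, the equation
becomes a renewal equation: `h` is the `p`-weighted mean of its delayed values up to an error `O(exp
(-d t))`. The theorem says that `h` is asymptotically periodic or convergent. The argument rests on
a maximum principle and on propagation of near-maximal values, without Fourier analysis or renewal
measures.

Near its upper limit, a mean can be near-maximal only if all its terms are (`Sub.tendsto_shift`).
Applied to `h (t + τ i) - h t`, this produces arbitrarily long runs of increments near their upper
limit. A positive limit would contradict boundedness of `h`, so every delay, hence the group they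
generate, consists of asymptotic periods (`closure_le_asymptoticPeriods`). The maximum principle
carries closeness from one window of length `span` to all later times (`abs_sub_le_of_window`). This
settles the lattice case, and the dense case for Lipschitz `h`.

For `h` continuous almost everywhere, the unit averages are Lipschitz and so converge to some `L`.
Near-maximal values of `h` recur on a fine progression covering a unit interval, while the mean
local oscillation is small (`exists_unitAvg_localSup_sub_le`). Hence the upper limit of `h` is at
most `L`; applying this to `-h` gives convergence. -/

/-- Weights and delays of a renewal equation, with exponential weight `d`. -/
structure RenewalWeights (ι : Type*) [Fintype ι] where
  p : ι → ℝ
  τ : ι → ℝ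
  d : ℝ
  p_pos : ∀ i, 0 < p i
  sum_p : ∑ i, p i = 1
  τ_pos : ∀ i, 0 < τ i
  d_pos : 0 < d
  two_le : 2 ≤ ∑ i, p i * Real.exp (d * τ i)

/-! ### Subsolutions, maximum principle and propagation of near-maxima -/

namespace RenewalWeights

variable {ι : Type*} [Fintype ι] (W : RenewalWeights ι)

/-- A common upper bound for the delays. -/
def span : ℝ := ∑ i, W.τ i

/-- The exponentially decaying size of the inhomogeneity. -/
noncomputable def decay (t : ℝ) : ℝ := Real.exp (-(W.d * t))

/-- The averaging operator of the renewal equation. -/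
def avg (v : ℝ → ℝ) (t : ℝ) : ℝ := ∑ i, W.p i * v (t - W.τ i)

/-- `v` is a subsolution up to an error `K * decay`. -/
def Sub (K : ℝ) (v : ℝ → ℝ) : Prop := ∀ t, v t ≤ W.avg v t + K * W.decay t

/-- Boundedness on every right half-line. -/
def _root_.BddRight (v : ℝ → ℝ) : Prop := ∀ A, ∃ C, ∀ t, A ≤ t → |v t| ≤ C

theorem nonempty (W : RenewalWeights ι) : Nonempty ι := by
  by_contra h
  rw [not_nonempty_iff] at h
  simpa using W.sum_p

theorem τ_le_span (i : ι) : W.τ i ≤ W.span :=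
  Finset.single_le_sum (f := W.τ) (fun j _ => (W.τ_pos j).le) (Finset.mem_univ i)

theorem span_pos : 0 < W.span := by
  obtain ⟨i⟩ := W.nonempty
  exact (W.τ_pos i).trans_le (W.τ_le_span i)

theorem exists_le_τ : ∃ δ, 0 < δ ∧ ∀ i, δ ≤ W.τ i := by
  have := W.nonempty
  obtain ⟨i, hi⟩ := Finite.exists_min W.τ
  exact ⟨W.τ i, W.τ_pos i, hi⟩

theorem decay_pos (t : ℝ) : 0 < W.decay t := Real.exp_pos _

theorem decay_anti {s t : ℝ} (h : s ≤ t) : W.decay t ≤ W.decay s := by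
  unfold decay
  have := mul_le_mul_of_nonneg_left h W.d_pos.le
  exact Real.exp_le_exp.2 (by linarith)

theorem decay_tendsto : Tendsto W.decay atTop (𝓝 0) :=
  Real.tendsto_exp_neg_atTop_nhds_zero.comp (tendsto_id.const_mul_atTop W.d_pos)

theorem decay_sub (s t : ℝ) : W.decay (t - s) = Real.exp (W.d * s) * W.decay t := by
  unfold decay
  rw [← Real.exp_add]
  congr 1
  ring

/-- The factor 2 leaves one spare copy of `decay`: if `v` is a subsolution with error `K * decay`,
then `v + K * decay` is one without error. -/
theorem two_mul_decay_le (t : ℝ) : 2 * W.decay t ≤ W.avg W.decay t := by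
  have : W.avg W.decay t = (∑ i, W.p i * Real.exp (W.d * W.τ i)) * W.decay t := by
    simp only [avg, W.decay_sub, Finset.sum_mul, mul_assoc]
  rw [this]
  exact mul_le_mul_of_nonneg_right W.two_le (W.decay_pos t).le

theorem avg_add (u v : ℝ → ℝ) (t : ℝ) : W.avg (fun s => u s + v s) t = W.avg u t + W.avg v t := by
  simp [avg, mul_add, Finset.sum_add_distrib]

theorem avg_sub (u v : ℝ → ℝ) (t : ℝ) : W.avg (fun s => u s - v s) t = W.avg u t - W.avg v t := by
  simp [avg, mul_sub, Finset.sum_sub_distrib]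

theorem avg_neg (u : ℝ → ℝ) (t : ℝ) : W.avg (fun s => - u s) t = - W.avg u t := by
  simp [avg]

theorem avg_const_mul (c : ℝ) (u : ℝ → ℝ) (t : ℝ) :
    W.avg (fun s => c * u s) t = c * W.avg u t := by
  simp only [avg, Finset.mul_sum]
  exact Finset.sum_congr rfl fun i _ => by ring

theorem avg_le_const {v : ℝ → ℝ} {t c : ℝ} (h : ∀ i, v (t - W.τ i) ≤ c) : W.avg v t ≤ c := by
  calc W.avg v t ≤ ∑ i, W.p i * c :=
        Finset.sum_le_sum fun i _ => mul_le_mul_of_nonneg_left (h i) (W.p_pos i).le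
    _ = c := by rw [← Finset.sum_mul, W.sum_p, one_mul]

variable {W}

/-- All delays lie between the least delay `δ` and `span`, so a bound on a window of length `span`
extends to the right in steps of `δ`. The set `Λ` allows the argument to run on a single coset of a
lattice. -/
theorem maximum_principle_of_le_avg {v : ℝ → ℝ} (hv : ∀ t, v t ≤ W.avg v t) {Λ : Set ℝ}
    (hΛ : ∀ t ∈ Λ, ∀ i, t - W.τ i ∈ Λ) {A c : ℝ}
    (hA : ∀ t ∈ Λ, A - W.span ≤ t → t < A → v t ≤ c) :
    ∀ t ∈ Λ, A - W.span ≤ t → v t ≤ c := by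
  obtain ⟨δ, hδ, hδτ⟩ := W.exists_le_τ
  have key : ∀ n : ℕ, ∀ t ∈ Λ, A - W.span ≤ t → t < A + n * δ → v t ≤ c := by
    intro n
    induction n with
    | zero => simpa using hA
    | succ n ih =>
      intro t ht h1 h2
      push_cast at h2
      by_cases h : t < A
      · exact hA t ht h1 h
      · refine (hv t).trans (W.avg_le_const fun i => ih _ (hΛ t ht i) ?_ ?_)
        · have := W.τ_le_span i
          linarith
        · have := hδτ i
          linarith
  intro t ht h1
  obtain ⟨n, hn⟩ := exists_nat_gt ((t - A) / δ)
  rw [div_lt_iff₀ hδ] at hn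
  exact key n t ht h1 (by linarith)

theorem Sub.maximum_principle {v : ℝ → ℝ} {K : ℝ} (hK : 0 ≤ K) (hv : W.Sub K v) {Λ : Set ℝ}
    (hΛ : ∀ t ∈ Λ, ∀ i, t - W.τ i ∈ Λ) {A c : ℝ}
    (hA : ∀ t ∈ Λ, A - W.span ≤ t → t < A → v t ≤ c) :
    ∀ t ∈ Λ, A - W.span ≤ t → v t ≤ c + K * W.decay (A - W.span) := by
  intro t ht h1
  have h := maximum_principle_of_le_avg (W := W) (v := fun s => v s + K * W.decay s)
    (c := c + K * W.decay (A - W.span)) (Λ := Λ) (A := A) ?_ hΛ ?_ t ht h1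
  · have := mul_nonneg hK (W.decay_pos t).le
    linarith
  · intro s
    rw [W.avg_add, W.avg_const_mul]
    have := hv s
    have := mul_le_mul_of_nonneg_left (W.two_mul_decay_le s) hK
    linarith
  · intro s hs h2 h3
    exact add_le_add (hA s hs h2 h3) (mul_le_mul_of_nonneg_left (W.decay_anti h2) hK)

/-- The delayed values are eventually at most `M + η`, while their mean is nearly at least `M`. As
each weight is positive, no single delayed value can fall far below `M`. -/
theorem Sub.tendsto_shift {v : ℝ → ℝ} {K M : ℝ} (hv : W.Sub K v)
    (hM : ∀ ε > 0, ∀ᶠ t in atTop, v t ≤ M + ε) {u : ℕ → ℝ} (hu : Tendsto u atTop atTop)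
    (huM : Tendsto (fun n => v (u n)) atTop (𝓝 M)) {s : ℝ}
    (hs : s ∈ AddSubmonoid.closure (Set.range W.τ)) :
    Tendsto (fun n => v (u n - s)) atTop (𝓝 M) := by
  have hshift : ∀ s : ℝ, Tendsto (fun n => u n - s) atTop atTop := fun s =>
    tendsto_atTop_add_const_right _ (-s) hu
  -- For a sum of shifts, the second shift is applied to the already shifted sequence, so `u` must
  -- vary.
  induction hs using AddSubmonoid.closure_induction generalizing u with
  | zero => simpa using huM
  | add x y hx hy hx' hy' =>
    have := hy' (hshift x) (hx' hu huM hshift) (fun s => by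
      simpa [sub_sub] using hshift (x + s))
    simpa [sub_sub] using this
  | mem x hx =>
    obtain ⟨i, rfl⟩ := hx
    rw [Metric.tendsto_atTop']
    intro ε hε
    have hdec : Tendsto (fun n => v (u n) - K * W.decay (u n)) atTop (𝓝 (M - K * 0)) :=
      huM.sub ((W.decay_tendsto.comp hu).const_mul K)
    -- The weighted deficit of the `i`-th term is below `2 * η`; dividing by `p i` leaves `ε / 2`.
    set η := ε * W.p i / 4 with hη
    have hpi := W.p_pos i
    have hηpos : 0 < η := by positivity
    have hpi1 : W.p i ≤ 1 := by
      rw [← W.sum_p]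
      exact Finset.single_le_sum (f := W.p) (fun j _ => (W.p_pos j).le) (Finset.mem_univ i)
    have e1 := hdec.eventually (lt_mem_nhds (show M - K * 0 - η < M - K * 0 by linarith))
    have e2 : ∀ᶠ n in atTop, ∀ j, v (u n - W.τ j) ≤ M + η :=
      eventually_all.2 fun j => (hshift (W.τ j)).eventually (hM η hηpos)
    obtain ⟨N, hN⟩ := eventually_atTop.1 (e1.and e2)
    refine ⟨N, fun n hn => ?_⟩
    obtain ⟨h1, h2⟩ := hN n hn.le
    have h3 := hv (u n)
    classical
    have h4 : W.avg v (u n) ≤ M + η - W.p i * (M + η - v (u n - W.τ i)) := by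
      have h5 : W.p i * (M + η - v (u n - W.τ i)) ≤
          ∑ j, W.p j * (M + η - v (u n - W.τ j)) :=
        Finset.single_le_sum (f := fun j => W.p j * (M + η - v (u n - W.τ j)))
          (fun j _ => mul_nonneg (W.p_pos j).le (by linarith [h2 j])) (Finset.mem_univ i)
      have h6 : ∑ j, W.p j * (M + η - v (u n - W.τ j)) = M + η - W.avg v (u n) := by
        simp only [mul_sub, Finset.sum_sub_distrib, ← Finset.sum_mul, W.sum_p, one_mul, avg]
      linarith
    have h7 : W.p i * (M + η - v (u n - W.τ i)) < W.p i * (ε / 2) := by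
      have : W.p i * (ε / 2) = 2 * η := by rw [hη]; ring
      linarith
    have h8 := lt_of_mul_lt_mul_left h7 hpi.le
    have h9 : η ≤ ε / 4 := by rw [hη]; nlinarith
    rw [Real.dist_eq, abs_lt]
    constructor
    · linarith
    · linarith [h2 i]

end RenewalWeights

/-- A function bounded on right half-lines attains its upper limit along a sequence. -/
theorem BddRight.exists_seq_limsup {v : ℝ → ℝ} (hv : BddRight v) :
    ∃ M : ℝ, (∀ ε > 0, ∀ᶠ t in atTop, v t ≤ M + ε) ∧
      ∃ u : ℕ → ℝ, Tendsto u atTop atTop ∧ Tendsto (fun n => v (u n)) atTop (𝓝 M) := by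
  obtain ⟨C, hC⟩ := hv 0
  have hb : IsBoundedUnder (· ≤ ·) atTop v :=
    ⟨C, (eventually_ge_atTop 0).mono fun t ht => (abs_le.1 (hC t ht)).2⟩
  have hb' : IsBoundedUnder (· ≥ ·) atTop v :=
    ⟨-C, (eventually_ge_atTop 0).mono fun t ht => (abs_le.1 (hC t ht)).1⟩
  have hM : ∀ ε > 0, ∀ᶠ t in atTop, v t ≤ limsup v atTop + ε := fun ε hε =>
    (eventually_lt_of_limsup_lt (show limsup v atTop < limsup v atTop + ε by linarith) hb).mono
      fun t ht => ht.le
  refine ⟨limsup v atTop, hM, ?_⟩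
  have hf : ∀ n : ℕ, ∃ t : ℝ, (n : ℝ) ≤ t ∧ limsup v atTop - 1 / ((n : ℝ) + 1) < v t := by
    intro n
    have hpos : (0 : ℝ) < 1 / ((n : ℝ) + 1) := by positivity
    have := frequently_lt_of_lt_limsup hb'.isCoboundedUnder_flip
      (show limsup v atTop - 1 / ((n : ℝ) + 1) < limsup v atTop by linarith)
    exact (frequently_atTop.1 this n).imp fun t ht => ht
  choose u hu1 hu2 using hf
  have hu : Tendsto u atTop atTop := tendsto_atTop_mono hu1 tendsto_natCast_atTop_atTop
  refine ⟨u, hu, ?_⟩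
  refine tendsto_order.2 ⟨fun a ha => ?_, fun a ha => ?_⟩
  · have h0 := (tendsto_one_div_add_atTop_nhds_zero_nat (𝕜 := ℝ)).eventually
      (gt_mem_nhds (show (0 : ℝ) < limsup v atTop - a by linarith))
    exact h0.mono fun n hn => by linarith [hu2 n]
  · exact (hu.eventually (hM ((a - limsup v atTop) / 2) (by linarith))).mono
      fun n hn => by linarith

/-- The real numbers `a` such that `v (t + a) - v t` tends to `0`. -/
def asymptoticPeriods (v : ℝ → ℝ) : AddSubgroup ℝ where
  carrier := {a | Tendsto (fun t => v (t + a) - v t) atTop (𝓝 0)}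
  zero_mem' := by simp
  add_mem' := by
    intro a b ha hb
    have h := (ha.comp (tendsto_atTop_add_const_right _ b tendsto_id)).add hb
    simp only [add_zero] at h
    refine h.congr fun t => ?_
    simp only [Function.comp, id]
    rw [show t + (a + b) = t + b + a by ring]
    ring
  neg_mem' := by
    intro a ha
    have h := (ha.comp (tendsto_atTop_add_const_right _ (-a) tendsto_id)).neg
    simp only [neg_zero] at h
    refine h.congr fun t => ?_
    simp [Function.comp]

theorem mem_asymptoticPeriods {v : ℝ → ℝ} {a : ℝ} :
    a ∈ asymptoticPeriods v ↔ Tendsto (fun t => v (t + a) - v t) atTop (𝓝 0) := Iff.rfl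

theorem BddRight.neg {v : ℝ → ℝ} (h : BddRight v) : BddRight fun t => - v t := fun A => by
  simpa using h A

/-! ### Delays are asymptotic periods -/

namespace RenewalWeights

variable {ι : Type*} [Fintype ι] {W : RenewalWeights ι}

theorem Sub.shift_sub {h : ℝ → ℝ} {K : ℝ} (hK : 0 ≤ K) (h1 : W.Sub K h)
    (h2 : W.Sub K fun t => - h t) {a : ℝ} (ha : 0 ≤ a) :
    W.Sub (2 * K) fun t => h (t + a) - h t := by
  intro t
  have e1 := h1 (t + a)
  have e2 := h2 t
  have e3 := mul_le_mul_of_nonneg_left (W.decay_anti (show t ≤ t + a by linarith)) hK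
  have e4 : W.avg (fun s => h (s + a)) t = W.avg h (t + a) := by
    simp only [avg]
    exact Finset.sum_congr rfl fun i _ => by rw [show t - W.τ i + a = t + a - W.τ i by ring]
  rw [W.avg_neg] at e2
  rw [W.avg_sub, e4]
  simp only at *
  linarith

theorem eventually_shift_sub_le {h : ℝ → ℝ} {K : ℝ} (hK : 0 ≤ K) (h1 : W.Sub K h)
    (h2 : W.Sub K fun t => - h t) (hb : BddRight h) (i : ι) {ε : ℝ} (hε : 0 < ε) :
    ∀ᶠ t in atTop, h (t + W.τ i) - h t ≤ ε := by
  have hτ := W.τ_pos i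
  obtain ⟨C, hC⟩ := hb 0
  have hbD : BddRight fun t => h (t + W.τ i) - h t := by
    intro A
    obtain ⟨C, hC⟩ := hb A
    refine ⟨C + C, fun t ht => (abs_sub _ _).trans (add_le_add (hC _ (by linarith)) (hC t ht))⟩
  obtain ⟨M, hM, u, hu, huM⟩ := hbD.exists_seq_limsup
  have hsub := h1.shift_sub hK h2 hτ.le
  have hM0 : M ≤ 0 := by
    -- Increments near `M` at `L` consecutive points spaced by `τ i` telescope to a difference of
    -- two values of `h`, at most `2 * C`; as `L` is arbitrary, `M ≤ 0`.
    have hL : ∀ L : ℕ, (L : ℝ) * M ≤ 2 * C := by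
      intro L
      have t1 : ∀ k : ℕ, Tendsto (fun n => h (u n - k * W.τ i + W.τ i) - h (u n - k * W.τ i))
          atTop (𝓝 M) := fun k =>
        hsub.tendsto_shift hM hu huM (by
          rw [← nsmul_eq_mul]
          exact nsmul_mem (AddSubmonoid.subset_closure (Set.mem_range_self i)) k)
      have t2 := tendsto_finsetSum (Finset.range L) fun k _ => t1 k
      simp only [Finset.sum_const, Finset.card_range, nsmul_eq_mul] at t2
      have t3 : ∀ n, ∑ k ∈ Finset.range L,
          (h (u n - k * W.τ i + W.τ i) - h (u n - k * W.τ i)) =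
          h (u n + W.τ i) - h (u n - L * W.τ i + W.τ i) := by
        intro n
        have := Finset.sum_range_sub' (fun k : ℕ => h (u n - k * W.τ i + W.τ i)) L
        simp only [Nat.cast_zero, zero_mul, sub_zero] at this
        rw [← this]
        refine Finset.sum_congr rfl fun k _ => ?_
        push_cast
        rw [show u n - (k + 1) * W.τ i + W.τ i = u n - k * W.τ i by ring]
      refine le_of_tendsto t2 ((hu.eventually_ge_atTop (L * W.τ i)).mono fun n hn => ?_)
      rw [t3]
      have hLτ : 0 ≤ L * W.τ i := by positivity
      have a1 := abs_le.1 (hC (u n + W.τ i) (by linarith))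
      have a2 := abs_le.1 (hC (u n - L * W.τ i + W.τ i) (by linarith))
      linarith [a1.2, a2.1]
    by_contra hcon
    push Not at hcon
    obtain ⟨L, hL'⟩ := exists_nat_gt (2 * C / M)
    rw [div_lt_iff₀ hcon] at hL'
    linarith [hL L]
  exact (hM ε hε).mono fun t ht => by linarith

theorem τ_mem_asymptoticPeriods {h : ℝ → ℝ} {K : ℝ} (hK : 0 ≤ K) (h1 : W.Sub K h)
    (h2 : W.Sub K fun t => - h t) (hb : BddRight h) (i : ι) : W.τ i ∈ asymptoticPeriods h := by
  rw [mem_asymptoticPeriods]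
  have h3 : W.Sub K fun t => - - h t := by simpa using h1
  refine tendsto_order.2 ⟨fun a ha => ?_, fun a ha => ?_⟩
  · exact (eventually_shift_sub_le hK h2 h3 hb.neg i
      (show 0 < -a / 2 by linarith)).mono fun t ht => by linarith
  · exact (eventually_shift_sub_le hK h1 h2 hb i
      (show 0 < a / 2 by linarith)).mono fun t ht => by linarith

theorem closure_le_asymptoticPeriods {h : ℝ → ℝ} {K : ℝ} (hK : 0 ≤ K) (h1 : W.Sub K h)
    (h2 : W.Sub K fun t => - h t) (hb : BddRight h) :
    AddSubgroup.closure (Set.range W.τ) ≤ asymptoticPeriods h :=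
  (AddSubgroup.closure_le _).2 (Set.range_subset_iff.2 (τ_mem_asymptoticPeriods hK h1 h2 hb))

/-- Values of a solution far out are controlled by those on a window. -/
theorem abs_sub_le_of_window {h : ℝ → ℝ} {K : ℝ} (hK : 0 ≤ K) (h1 : W.Sub K h)
    (h2 : W.Sub K fun t => - h t) {Λ : Set ℝ} (hΛ : ∀ t ∈ Λ, ∀ i, t - W.τ i ∈ Λ) {A ε c : ℝ}
    (hA : ∀ t ∈ Λ, A - W.span ≤ t → t < A → |h t - c| ≤ ε) {t : ℝ} (ht : t ∈ Λ)
    (hAt : A ≤ t) : |h t - c| ≤ ε + K * W.decay (A - W.span) := by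
  have hs := W.span_pos
  have a1 := h1.maximum_principle hK hΛ (A := A) (c := c + ε)
    (fun s hs h3 h4 => by linarith [(abs_le.1 (hA s hs h3 h4)).2]) t ht (by linarith)
  have a2 := h2.maximum_principle hK hΛ (A := A) (c := -c + ε)
    (fun s hs h3 h4 => by linarith [(abs_le.1 (hA s hs h3 h4)).1]) t ht (by linarith)
  rw [abs_le]
  constructor <;> linarith

end RenewalWeights

/-- Moving back by boundedly many asymptotic periods changes little. -/
theorem eventually_abs_sub_nat_mul_le {v : ℝ → ℝ} {a : ℝ} (ha : a ∈ asymptoticPeriods v) (N : ℕ)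
    {ε : ℝ} (hε : 0 < ε) : ∀ᶠ t in atTop, ∀ k ≤ N, |v (t - k * a) - v t| ≤ ε := by
  have h : ∀ k : ℕ, ∀ᶠ t in atTop, |v (t - k * a) - v t| ≤ ε := by
    intro k
    have hk : -(k • a) ∈ asymptoticPeriods v := neg_mem (nsmul_mem ha k)
    rw [mem_asymptoticPeriods] at hk
    have := (hk.abs).eventually (gt_mem_nhds (show |(0 : ℝ)| < ε by simpa using hε))
    refine this.mono fun t ht => ?_
    rw [nsmul_eq_mul, ← sub_eq_add_neg] at ht
    exact ht.le
  exact (eventually_all_finset (Finset.range (N + 1))).2 (fun k _ => h k) |>.mono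
    fun t ht k hk => ht k (by simp; omega)

/-- A real function that is uniformly Cauchy at infinity converges. -/
theorem exists_tendsto_of_uniform {v : ℝ → ℝ}
    (h : ∀ ε > 0, ∃ A, ∀ t, A ≤ t → |v t - v A| ≤ ε) : ∃ L, Tendsto v atTop (𝓝 L) := by
  refine cauchy_map_iff_exists_tendsto.1 (Metric.cauchy_iff.2 ⟨inferInstance, fun ε hε => ?_⟩)
  obtain ⟨A, hA⟩ := h (ε / 3) (by positivity)
  refine ⟨v '' Set.Ici A, image_mem_map (Ici_mem_atTop A), ?_⟩
  rintro _ ⟨s, hs, rfl⟩ _ ⟨t, ht, rfl⟩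
  have h1 := hA s hs
  have h2 := hA t ht
  rw [Real.dist_eq, abs_lt]
  rw [abs_le] at h1 h2
  constructor <;> linarith

/-! ### Lattice case, and dense case for Lipschitz solutions -/

namespace RenewalWeights

variable {ι : Type*} [Fintype ι] {W : RenewalWeights ι}

theorem eventually_mul_decay_le (W : RenewalWeights ι) (K s : ℝ) {ε : ℝ} (hε : 0 < ε) :
    ∀ᶠ t in atTop, K * W.decay (t - s) ≤ ε := by
  have h := (W.decay_tendsto.comp (tendsto_atTop_add_const_right _ (-s) tendsto_id)).const_mul K
  rw [mul_zero] at h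
  exact (h.eventually (gt_mem_nhds hε)).mono fun t ht => ht.le

/-- Renewal theorem, lattice case. -/
theorem exists_periodic_of_lattice {h : ℝ → ℝ} {K : ℝ} (hK : 0 ≤ K) (h1 : W.Sub K h)
    (h2 : W.Sub K fun t => - h t) (hb : BddRight h) {T : ℝ} (hT : 0 < T)
    (hW : AddSubgroup.closure (Set.range W.τ) = AddSubgroup.zmultiples T) :
    ∃ G : ℝ → ℝ, Function.Periodic G T ∧ Tendsto (fun t => h t - G t) atTop (𝓝 0) := by
  have hTmem : T ∈ asymptoticPeriods h :=
    closure_le_asymptoticPeriods hK h1 h2 hb (hW ▸ AddSubgroup.mem_zmultiples T)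
  obtain ⟨N, hN⟩ := exists_nat_gt (W.span / T)
  rw [div_lt_iff₀ hT] at hN
  have key : ∀ ε > 0, ∃ A, ∀ t, A ≤ t → ∀ n : ℕ, |h (t + n * T) - h t| ≤ ε := by
    intro ε hε
    obtain ⟨A, hA⟩ := eventually_atTop.1
      ((eventually_abs_sub_nat_mul_le hTmem N (half_pos hε)).and
        (W.eventually_mul_decay_le K W.span (half_pos hε)))
    refine ⟨A, fun t ht n => ?_⟩
    obtain ⟨e1, e2⟩ := hA t ht
    -- The coset of `t` modulo `T` is stable under the delays, so the maximum principle applies on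
    -- it, where the window has only finitely many points.
    have hΛ : ∀ s ∈ {s | s - t ∈ AddSubgroup.zmultiples T}, ∀ i,
        s - W.τ i ∈ {s | s - t ∈ AddSubgroup.zmultiples T} := by
      intro s hs i
      have hi : W.τ i ∈ AddSubgroup.zmultiples T :=
        hW ▸ AddSubgroup.subset_closure (Set.mem_range_self i)
      have := sub_mem hs hi
      rwa [show s - t - W.τ i = s - W.τ i - t by ring] at this
    have := abs_sub_le_of_window hK h1 h2 hΛ (A := t) (ε := ε / 2) (c := h t) ?_
      (t := t + n * T) ?_ ?_
    · linarith
    · rintro s ⟨k, hk⟩ h3 h4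
      simp only [zsmul_eq_mul] at hk
      -- Since `span < N * T`, the points of the coset in the window are `t - j * T` with `1 ≤ j ≤
      -- N`, all handled by `e1`.
      have hk1 : k < 0 := by
        by_contra hcon
        push Not at hcon
        have : (0 : ℝ) ≤ k * T := mul_nonneg (by exact_mod_cast hcon) hT.le
        linarith
      have hk2 : -(N : ℤ) ≤ k := by
        by_contra hcon
        push Not at hcon
        have h5 : (k : ℝ) ≤ -N := by exact_mod_cast hcon.le
        have := mul_le_mul_of_nonneg_right h5 hT.le
        linarith
      obtain ⟨j, rfl⟩ := Int.exists_eq_neg_ofNat hk1.le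
      have := e1 j (by omega)
      push_cast at hk
      rwa [show t - j * T = s by linarith] at this
    · exact ⟨n, by simp⟩
    · have : 0 ≤ n * T := by positivity
      linarith
  have hlim : ∀ s, ∃ L, Tendsto (fun n : ℕ => h (s + n * T)) atTop (𝓝 L) := by
    intro s
    refine cauchySeq_tendsto_of_complete (Metric.cauchySeq_iff'.2 fun ε hε => ?_)
    obtain ⟨A, hA⟩ := key (ε / 2) (half_pos hε)
    obtain ⟨n₀, hn₀⟩ := exists_nat_gt ((A - s) / T)
    rw [div_lt_iff₀ hT] at hn₀
    refine ⟨n₀, fun n hn => ?_⟩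
    obtain ⟨k, rfl⟩ := Nat.exists_eq_add_of_le hn
    have := hA (s + n₀ * T) (by linarith) k
    rw [Real.dist_eq]
    push_cast
    rw [show s + (n₀ + k) * T = s + n₀ * T + k * T by ring]
    linarith
  choose G hG using hlim
  refine ⟨G, fun s => ?_, ?_⟩
  · refine tendsto_nhds_unique (hG (s + T)) (((tendsto_add_atTop_iff_nat 1).2 (hG s)).congr ?_)
    intro n
    congr 1
    push_cast
    ring
  · rw [Metric.tendsto_atTop]
    intro ε hε
    obtain ⟨A, hA⟩ := key (ε / 2) (half_pos hε)
    refine ⟨A, fun t ht => ?_⟩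
    have := le_of_tendsto ((hG t).sub_const (h t)).abs (Eventually.of_forall (hA t ht))
    rw [Real.dist_eq, sub_zero, abs_sub_comm]
    linarith

/-- The group generated by the delays consists of differences of sums of delays. -/
theorem exists_sub_of_mem_closure {S : Set ℝ} {a : ℝ} (ha : a ∈ AddSubgroup.closure S) :
    ∃ s ∈ AddSubmonoid.closure S, ∃ s' ∈ AddSubmonoid.closure S, a = s - s' := by
  induction ha using AddSubgroup.closure_induction with
  | mem x hx => exact ⟨x, AddSubmonoid.subset_closure hx, 0, zero_mem _, by simp⟩
  | zero => exact ⟨0, zero_mem _, 0, zero_mem _, by simp⟩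
  | add x y _ _ hx hy =>
    obtain ⟨s, hs, s', hs', rfl⟩ := hx
    obtain ⟨r, hr, r', hr', rfl⟩ := hy
    exact ⟨s + r, add_mem hs hr, s' + r', add_mem hs' hr', by ring⟩
  | neg x _ hx =>
    obtain ⟨s, hs, s', hs', rfl⟩ := hx
    exact ⟨s', hs', s, hs, by ring⟩

theorem exists_mem_closure_Ioo
    (hW : Dense (AddSubgroup.closure (Set.range W.τ) : Set ℝ)) {δ : ℝ} (hδ : 0 < δ) :
    ∃ a ∈ AddSubgroup.closure (Set.range W.τ), 0 < a ∧ a < δ :=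
  let ⟨a, ha, h⟩ := hW.exists_between hδ
  ⟨a, ha, h⟩

/-- A step of an arithmetic progression of length covering `L` lands near each point. -/
theorem exists_nat_abs_sub_lt {a L x t : ℝ} (ha : 0 < a) {N : ℕ} (hN : L ≤ N * a)
    (h1 : t - L ≤ x) (h2 : x ≤ t) : ∃ k ≤ N, |x - (t - k * a)| < a := by
  refine ⟨⌊(t - x) / a⌋₊, ?_, ?_⟩
  · refine Nat.floor_le_of_le ?_
    rw [div_le_iff₀ ha]
    linarith
  · have e1 := Nat.floor_le (div_nonneg (sub_nonneg.2 h2) ha.le)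
    have e2 := Nat.lt_floor_add_one ((t - x) / a)
    rw [le_div_iff₀ ha] at e1
    rw [div_lt_iff₀ ha] at e2
    rw [abs_lt]
    constructor <;> linarith

/-- Renewal theorem, non-lattice case, for Lipschitz solutions. -/
theorem exists_tendsto_of_lipschitz {h : ℝ → ℝ} {K C : ℝ} (hK : 0 ≤ K) (h1 : W.Sub K h)
    (h2 : W.Sub K fun t => - h t) (hb : BddRight h)
    (hLip : ∀ s t, 0 ≤ s → 0 ≤ t → |h s - h t| ≤ C * |s - t|)
    (hW : Dense (AddSubgroup.closure (Set.range W.τ) : Set ℝ)) :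
    ∃ L, Tendsto h atTop (𝓝 L) := by
  refine exists_tendsto_of_uniform fun ε hε => ?_
  have hC : 0 ≤ C := by
    have := (abs_nonneg _).trans (hLip 0 1 le_rfl zero_le_one)
    simpa using this
  -- With this bound on `a`, moving to the nearest chosen progression point costs at most `C * a ≤ ε
  -- / 3`.
  obtain ⟨a, ha, ha0, haδ⟩ := exists_mem_closure_Ioo hW (show 0 < ε / (3 * (C + 1)) by positivity)
  rw [lt_div_iff₀ (by positivity)] at haδ
  obtain ⟨N, hN⟩ := exists_nat_gt (W.span / a)
  rw [div_lt_iff₀ ha0] at hN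
  have hamem := closure_le_asymptoticPeriods hK h1 h2 hb ha
  -- The condition `N * a ≤ A` keeps the progression and the window in the half-line where the
  -- Lipschitz bound holds.
  obtain ⟨A, ⟨e1, e2⟩, e3⟩ := (((eventually_abs_sub_nat_mul_le hamem N
    (show 0 < ε / 3 by positivity)).and (W.eventually_mul_decay_le K W.span
    (show 0 < ε / 3 by positivity))).and (eventually_ge_atTop (N * a))).exists
  refine ⟨A, fun t ht => ?_⟩
  have := abs_sub_le_of_window hK h1 h2 (Λ := Set.univ) (by simp) (A := A) (ε := 2 * ε / 3)
    (c := h A) ?_ (Set.mem_univ t) ht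
  · linarith
  · intro s _ h3 h4
    obtain ⟨k, hk, hka⟩ := exists_nat_abs_sub_lt ha0 hN.le h3 h4.le
    have a1 := e1 k hk
    have hkN : (k : ℝ) * a ≤ N * a := mul_le_mul_of_nonneg_right (by exact_mod_cast hk) ha0.le
    have a2 := hLip s (A - k * a) (by linarith) (by linarith)
    have a3 := mul_le_mul_of_nonneg_left hka.le hC
    have a4 := abs_sub_le (h s) (h (A - k * a)) (h A)
    nlinarith

end RenewalWeights

/-! ### Unit averages and local suprema -/

/-- The continuity points form a Gδ set of full measure, on which `v` is continuous. -/
theorem aestronglyMeasurable_of_ae_continuousAt {v : ℝ → ℝ} (hv : ∀ᵐ t, ContinuousAt v t) :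
    AEStronglyMeasurable v volume := by
  have hmeas : MeasurableSet {t | ContinuousAt v t} := (IsGδ.setOfPred_continuousAt v).measurableSet
  have hcont : ContinuousOn v {t | ContinuousAt v t} := fun t ht => ht.continuousWithinAt
  have h := hcont.aestronglyMeasurable (μ := volume) hmeas
  rwa [Measure.restrict_eq_self_of_ae_mem (s := {t | ContinuousAt v t}) hv] at h

theorem BddRight.intervalIntegrable {v : ℝ → ℝ} (hb : BddRight v)
    (hv : AEStronglyMeasurable v volume) (a b : ℝ) : IntervalIntegrable v volume a b := by
  obtain ⟨C, hC⟩ := hb (min a b)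
  rw [intervalIntegrable_iff]
  refine Measure.integrableOn_of_bounded (M := C) (by simp) hv ?_
  refine (ae_restrict_iff' measurableSet_uIoc).2 (Eventually.of_forall fun t ht => ?_)
  exact hC t ht.1.le

/-- Average over the unit interval to the right. -/
noncomputable def unitAvg (v : ℝ → ℝ) (t : ℝ) : ℝ := ∫ s in t..t + 1, v s

theorem unitAvg_neg (v : ℝ → ℝ) (t : ℝ) : unitAvg (fun s => - v s) t = - unitAvg v t := by
  simp [unitAvg]

theorem BddRight.unitAvg {v : ℝ → ℝ} (hb : BddRight v) : BddRight (unitAvg v) := by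
  intro A
  obtain ⟨C, hC⟩ := hb A
  refine ⟨C, fun t ht => ?_⟩
  have := intervalIntegral.norm_integral_le_of_norm_le_const (a := t) (b := t + 1) (f := v)
    (C := C) fun s hs => hC s (by
      rw [Set.uIoc_of_le (by linarith)] at hs
      linarith [hs.1])
  simpa [_root_.unitAvg] using this

theorem BddRight.exists_lipschitz_unitAvg {v : ℝ → ℝ} (hb : BddRight v)
    (hv : AEStronglyMeasurable v volume) :
    ∃ C, ∀ s t, 0 ≤ s → 0 ≤ t → |_root_.unitAvg v s - _root_.unitAvg v t| ≤ C * |s - t| := by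
  obtain ⟨C, hC⟩ := hb 0
  have hI := hb.intervalIntegrable hv
  have hbound : ∀ s t, 0 ≤ s → 0 ≤ t → |∫ x in s..t, v x| ≤ C * |t - s| := by
    intro s t hs ht
    rw [← Real.norm_eq_abs]
    exact intervalIntegral.norm_integral_le_of_norm_le_const fun x hx => hC x
      ((le_min hs ht).trans hx.1.le)
  refine ⟨2 * C, fun s t hs ht => ?_⟩
  unfold _root_.unitAvg
  rw [intervalIntegral.integral_interval_sub_interval_comm (hI _ _) (hI _ _) (hI _ _)]
  have e1 := hbound s t hs ht
  have e2 := hbound (s + 1) (t + 1) (by linarith) (by linarith)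
  rw [show t + 1 - (s + 1) = t - s by ring] at e2
  rw [abs_sub_comm s t]
  refine (abs_sub _ _).trans ?_
  linarith

/-- Supremum over the ball of radius `ρ`. -/
noncomputable def localSup (ρ : ℝ) (v : ℝ → ℝ) (t : ℝ) : ℝ := sSup (v '' Metric.ball t ρ)

theorem BddRight.bddAbove_ball {v : ℝ → ℝ} (hb : BddRight v) (t ρ : ℝ) :
    BddAbove (v '' Metric.ball t ρ) := by
  obtain ⟨C, hC⟩ := hb (t - ρ)
  refine ⟨C, ?_⟩
  rintro _ ⟨s, hs, rfl⟩
  rw [Real.ball_eq_Ioo] at hs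
  exact (abs_le.1 (hC s hs.1.le)).2

theorem BddRight.le_localSup {v : ℝ → ℝ} (hb : BddRight v) {s t ρ : ℝ} (h : |s - t| < ρ) :
    v s ≤ localSup ρ v t :=
  le_csSup (hb.bddAbove_ball t ρ) (Set.mem_image_of_mem v h)

theorem localSup_le {v : ℝ → ℝ} {t ρ c : ℝ} (hρ : 0 < ρ) (h : ∀ s, |s - t| < ρ → v s ≤ c) :
    localSup ρ v t ≤ c := by
  refine csSup_le ((Metric.nonempty_ball.2 hρ).image v) ?_
  rintro _ ⟨s, hs, rfl⟩
  exact h s hs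

theorem BddRight.abs_localSup_le {v : ℝ → ℝ} (hb : BddRight v) {ρ A C : ℝ} (hρ : 0 < ρ)
    (hC : ∀ t, A - ρ ≤ t → |v t| ≤ C) {t : ℝ} (ht : A ≤ t) : |localSup ρ v t| ≤ C := by
  rw [abs_le]
  constructor
  · refine (abs_le.1 (hC t (by linarith))).1.trans (hb.le_localSup ?_)
    simpa using hρ
  · refine localSup_le hρ fun s hs => (abs_le.1 (hC s ?_)).2
    linarith [(abs_lt.1 hs).1]

theorem BddRight.localSup {v : ℝ → ℝ} (hb : BddRight v) {ρ : ℝ} (hρ : 0 < ρ) :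
    BddRight (localSup ρ v) := by
  intro A
  obtain ⟨C, hC⟩ := hb (A - ρ)
  exact ⟨C, fun t ht => hb.abs_localSup_le hρ hC ht⟩

/-- Each strict superlevel set is a union of open balls, so the local supremum is lower
semicontinuous whether or not `v` is measurable. -/
theorem BddRight.measurable_localSup {v : ℝ → ℝ} (hb : BddRight v) {ρ : ℝ} (hρ : 0 < ρ) :
    Measurable (_root_.localSup ρ v) := by
  refine measurable_of_Ioi fun c => IsOpen.measurableSet ?_
  have : _root_.localSup ρ v ⁻¹' Set.Ioi c = ⋃ s ∈ {s | c < v s}, Metric.ball s ρ := by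
    ext t
    simp only [Set.mem_preimage, Set.mem_Ioi, Set.mem_iUnion, Set.mem_ofPred_eq, exists_prop]
    rw [_root_.localSup,
      lt_csSup_iff (hb.bddAbove_ball t ρ) ((Metric.nonempty_ball.2 hρ).image v)]
    simp only [Set.exists_mem_image]
    refine exists_congr fun s => ?_
    rw [Metric.mem_ball_comm, and_comm]
  rw [this]
  exact isOpen_biUnion fun s _ => Metric.isOpen_ball

theorem BddRight.tendsto_localSup {v : ℝ → ℝ} (hb : BddRight v) {t : ℝ} (ht : ContinuousAt v t) :
    Tendsto (fun n : ℕ => _root_.localSup (1 / ((n : ℝ) + 1)) v t) atTop (𝓝 (v t)) := by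
  have hpos : ∀ n : ℕ, (0 : ℝ) < 1 / ((n : ℝ) + 1) := fun n => by positivity
  have hge : ∀ n : ℕ, v t ≤ _root_.localSup (1 / ((n : ℝ) + 1)) v t := fun n =>
    hb.le_localSup (by simpa using hpos n)
  refine tendsto_order.2 ⟨fun a ha => Eventually.of_forall fun n => ha.trans_le (hge n),
    fun a ha => ?_⟩
  obtain ⟨δ, hδ, hδ'⟩ := Metric.continuousAt_iff.1 ht ((a - v t) / 2) (by linarith)
  refine (tendsto_one_div_add_atTop_nhds_zero_nat.eventually (gt_mem_nhds hδ)).mono fun n hn => ?_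
  refine (localSup_le (c := v t + (a - v t) / 2) (hpos n) fun s hs => ?_).trans_lt (by linarith)
  have := hδ' (hs.trans hn)
  rw [Real.dist_eq, abs_lt] at this
  linarith [this.2]

/-! ### Dense case for almost everywhere continuous solutions -/

namespace RenewalWeights

variable {ι : Type*} [Fintype ι] {W : RenewalWeights ι}

theorem Sub.unitAvg {v : ℝ → ℝ} {K : ℝ} (hK : 0 ≤ K) (hv : W.Sub K v)
    (hI : ∀ a b, IntervalIntegrable v volume a b) : W.Sub K (unitAvg v) := by
  intro t
  have hcont : Continuous W.decay := by
    unfold decay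
    fun_prop
  have hIτ : ∀ i, IntervalIntegrable (fun s => v (s - W.τ i)) volume t (t + 1) := by
    intro i
    simpa using (hI (t - W.τ i) (t + 1 - W.τ i)).comp_sub_right (W.τ i)
  have hIavg : IntervalIntegrable (W.avg v) volume t (t + 1) := by
    have := IntervalIntegrable.sum Finset.univ (f := fun i s => W.p i * v (s - W.τ i))
      fun i _ => (hIτ i).const_mul (W.p i)
    have e : W.avg v = ∑ i, fun s => W.p i * v (s - W.τ i) := by
      funext s
      simp [avg]
    rwa [e]
  have hIdec : IntervalIntegrable (fun s => K * W.decay s) volume t (t + 1) :=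
    (continuous_const.mul hcont).intervalIntegrable _ _
  have e1 : _root_.unitAvg v t ≤ ∫ s in t..t + 1, (W.avg v s + K * W.decay s) :=
    intervalIntegral.integral_mono_on (by linarith) (hI _ _) (hIavg.add hIdec) fun s _ => hv s
  rw [intervalIntegral.integral_add hIavg hIdec] at e1
  have e2 : ∫ s in t..t + 1, W.avg v s = W.avg (_root_.unitAvg v) t := by
    simp only [avg, _root_.unitAvg]
    rw [intervalIntegral.integral_finsetSum fun i _ => (hIτ i).const_mul (W.p i)]
    refine Finset.sum_congr rfl fun i _ => ?_
    rw [intervalIntegral.integral_const_mul, intervalIntegral.integral_comp_sub_right,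
      show t + 1 - W.τ i = t - W.τ i + 1 by ring]
  have e3 : ∫ s in t..t + 1, K * W.decay s ≤ ∫ s in t..t + 1, K * W.decay t :=
    intervalIntegral.integral_mono_on (by linarith) hIdec (by simp) fun s hs =>
      mul_le_mul_of_nonneg_left (W.decay_anti hs.1) hK
  simp only [intervalIntegral.integral_const, add_sub_cancel_left, one_smul] at e3
  linarith

/-- A supremum of means is at most the mean of the suprema. The factor `exp d` pays for evaluating
`decay` up to distance 1 to the left. -/
theorem Sub.localSup {v : ℝ → ℝ} {K : ℝ} (hK : 0 ≤ K) (hv : W.Sub K v) (hb : BddRight v) {ρ : ℝ}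
    (hρ : 0 < ρ) (hρ1 : ρ ≤ 1) : W.Sub (K * Real.exp W.d) (localSup ρ v) := by
  intro t
  refine localSup_le hρ fun s hs => (hv s).trans (add_le_add ?_ ?_)
  · refine Finset.sum_le_sum fun i _ => mul_le_mul_of_nonneg_left ?_ (W.p_pos i).le
    exact hb.le_localSup (by rwa [sub_sub_sub_cancel_right])
  · rw [mul_assoc]
    refine mul_le_mul_of_nonneg_left ?_ hK
    have := W.decay_sub 1 t
    rw [mul_one] at this
    rw [← this]
    exact W.decay_anti (by linarith [(abs_lt.1 hs).1])

/-- The mean local oscillation of a solution at infinity is small at small scales. -/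
theorem exists_unitAvg_localSup_sub_le {h : ℝ → ℝ} {K : ℝ} (hK : 0 ≤ K) (h1 : W.Sub K h)
    (h2 : W.Sub K fun t => - h t) (hb : BddRight h) (hc : ∀ᵐ t, ContinuousAt h t) {ε : ℝ}
    (hε : 0 < ε) : ∃ ρ > 0, ∀ᶠ t in atTop, unitAvg (fun s => localSup ρ h s - h s) t ≤ ε := by
  have hm := aestronglyMeasurable_of_ae_continuousAt hc
  -- `A` is fixed before `ρ`: the error constant of the oscillation does not depend on `ρ` as long
  -- as `ρ ≤ 1`.
  obtain ⟨A, hA⟩ := (W.eventually_mul_decay_le (K * Real.exp W.d + K) W.span (half_pos hε)).exists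
  obtain ⟨C, hC⟩ := hb (A - W.span - 1)
  have hpos : ∀ n : ℕ, (0 : ℝ) < 1 / ((n : ℝ) + 1) := fun n => by positivity
  have hle : ∀ n : ℕ, 1 / ((n : ℝ) + 1) ≤ 1 := fun n => by
    rw [div_le_one (by positivity)]
    linarith [n.cast_nonneg (α := ℝ)]
  have hspan := W.span_pos
  -- This interval contains every unit interval starting in the window before `A`. The oscillation
  -- tends to 0 at continuity points, hence in mean by dominated convergence; the maximum principle
  -- then propagates the smallness to all later times.
  have hlim : Tendsto (fun n : ℕ => ∫ s in (A - W.span)..(A + 1),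
      (_root_.localSup (1 / ((n : ℝ) + 1)) h s - h s)) atTop
      (𝓝 (∫ s in (A - W.span)..(A + 1), (0 : ℝ))) := by
    refine intervalIntegral.tendsto_integral_filter_of_dominated_convergence (fun _ => C + C)
      (Eventually.of_forall fun n =>
        ((hb.measurable_localSup (hpos n)).aestronglyMeasurable.sub hm).restrict)
      (Eventually.of_forall fun n => Eventually.of_forall fun s hs => ?_) (by simp) ?_
    · rw [Set.uIoc_of_le (by linarith)] at hs
      refine (abs_sub _ _).trans (add_le_add ?_ (hC s (by linarith [hs.1])))
      refine hb.abs_localSup_le (hpos n) (fun t ht => hC t ?_) hs.1.le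
      linarith [hle n]
    · refine hc.mono fun s hs _ => ?_
      simpa using (hb.tendsto_localSup hs).sub_const (h s)
  rw [intervalIntegral.integral_zero] at hlim
  obtain ⟨n, hn⟩ := (hlim.eventually (gt_mem_nhds (half_pos hε))).exists
  set ρ : ℝ := 1 / ((n : ℝ) + 1)
  have hI : ∀ a b, IntervalIntegrable (fun s => _root_.localSup ρ h s - h s) volume a b :=
    fun a b => ((hb.localSup (hpos n)).intervalIntegrable
      (hb.measurable_localSup (hpos n)).aestronglyMeasurable a b).sub
      (hb.intervalIntegrable hm a b)
  have hnonneg : ∀ s, 0 ≤ _root_.localSup ρ h s - h s := fun s =>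
    sub_nonneg.2 (hb.le_localSup (by rw [sub_self, abs_zero]; exact hpos n))
  have hsub : W.Sub (K * Real.exp W.d + K) fun s => _root_.localSup ρ h s - h s := by
    intro t
    have e1 := (h1.localSup hK hb (hpos n) (hle n)) t
    have e2 := h2 t
    rw [W.avg_neg] at e2
    rw [W.avg_sub]
    linarith
  have hK' : 0 ≤ K * Real.exp W.d + K := by positivity
  refine ⟨ρ, hpos n, (eventually_ge_atTop A).mono fun t ht => ?_⟩
  have := (hsub.unitAvg hK' hI).maximum_principle hK' (Λ := Set.univ) (by simp) (A := A)
    (c := ε / 2) ?_ t (Set.mem_univ t) (by linarith)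
  · linarith
  · intro s _ h3 h4
    refine le_trans ?_ hn.le
    exact intervalIntegral.integral_mono_interval h3 (by linarith) (by linarith)
      (Eventually.of_forall hnonneg) (hI _ _)

/-- If `M` is the upper limit, the local supremum exceeds `M - ε / 4` throughout some far unit
interval, and its mean exceeds that of `h` by at most `ε / 4`. As the mean of `h` is below `L + ε /
4` there, `M < L + 3 * ε / 4`. -/
theorem eventually_le_of_tendsto_unitAvg {h : ℝ → ℝ} {K L : ℝ} (hK : 0 ≤ K) (h1 : W.Sub K h)
    (h2 : W.Sub K fun t => - h t) (hb : BddRight h) (hc : ∀ᵐ t, ContinuousAt h t)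
    (hW : Dense (AddSubgroup.closure (Set.range W.τ) : Set ℝ))
    (hL : Tendsto (unitAvg h) atTop (𝓝 L)) {ε : ℝ} (hε : 0 < ε) :
    ∀ᶠ t in atTop, h t ≤ L + ε := by
  have hm := aestronglyMeasurable_of_ae_continuousAt hc
  obtain ⟨M, hM, u, hu, huM⟩ := hb.exists_seq_limsup
  obtain ⟨ρ, hρ, hosc⟩ := exists_unitAvg_localSup_sub_le hK h1 h2 hb hc
    (show 0 < ε / 4 by positivity)
  obtain ⟨a, ha, ha0, haρ⟩ := exists_mem_closure_Ioo hW hρ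
  obtain ⟨s, hs, s', hs', has⟩ := exists_sub_of_mem_closure ha
  obtain ⟨N, hN⟩ := exists_nat_gt (1 / a)
  rw [div_lt_iff₀ ha0] at hN
  -- Near-maxima propagate only along sums of delays, whereas `a = s - s'` is a difference. Starting
  -- from `u n - N * s'` compensates: the total shift is `k * s + (N - k) * s'`.
  have e1 : ∀ᶠ n in atTop, ∀ k ∈ Finset.range (N + 1),
      M - ε / 4 < h (u n - N * s' - k * a) := by
    refine (eventually_all_finset _).2 fun k hk => ?_
    have hkN : k ≤ N := by simpa [Nat.lt_succ_iff] using hk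
    have := h1.tendsto_shift hM hu huM
      (add_mem (nsmul_mem hs k) (nsmul_mem hs' (N - k)))
    refine (this.eventually (lt_mem_nhds (show M - ε / 4 < M by linarith))).mono fun n hn => ?_
    rw [nsmul_eq_mul, nsmul_eq_mul, Nat.cast_sub hkN] at hn
    rwa [show u n - N * s' - k * a = u n - (k * s + (N - k) * s') by rw [has]; ring]
  have ht : Tendsto (fun n => u n - N * s' - 1) atTop atTop :=
    tendsto_atTop_add_const_right _ (-1) (tendsto_atTop_add_const_right _ (-(N * s')) hu)
  obtain ⟨n, ⟨e1, e2⟩, e3⟩ := ((e1.and (ht.eventually hosc)).and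
    (ht.eventually (hL.eventually (gt_mem_nhds (show L < L + ε / 4 by linarith))))).exists
  set t := u n - N * s' - 1
  have hIh := hb.intervalIntegrable hm t (t + 1)
  have hIs := (hb.localSup hρ).intervalIntegrable
    (hb.measurable_localSup hρ).aestronglyMeasurable t (t + 1)
  have e4 : M - ε / 4 ≤ ∫ x in t..t + 1, localSup ρ h x := by
    have : ∫ x in t..t + 1, (M - ε / 4) ≤ ∫ x in t..t + 1, localSup ρ h x := by
      refine intervalIntegral.integral_mono_on (by linarith) (by simp) hIs fun x hx => ?_
      obtain ⟨k, hk, hkx⟩ := exists_nat_abs_sub_lt ha0 hN.le (x := x) (t := u n - N * s')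
        hx.1 (by linarith [hx.2])
      refine (e1 k (by simp; omega)).le.trans (hb.le_localSup ?_)
      rw [abs_sub_comm]
      exact hkx.trans haρ
    simpa using this
  have e5 : unitAvg (fun s => localSup ρ h s - h s) t =
      (∫ x in t..t + 1, localSup ρ h x) - unitAvg h t := intervalIntegral.integral_sub hIs hIh
  exact (hM (ε / 4) (by positivity)).mono fun x hx => by linarith

/-- Renewal theorem, non-lattice case, for almost everywhere continuous solutions. -/
theorem exists_tendsto_of_dense {h : ℝ → ℝ} {K : ℝ} (hK : 0 ≤ K) (h1 : W.Sub K h)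
    (h2 : W.Sub K fun t => - h t) (hb : BddRight h) (hc : ∀ᵐ t, ContinuousAt h t)
    (hW : Dense (AddSubgroup.closure (Set.range W.τ) : Set ℝ)) :
    ∃ L, Tendsto h atTop (𝓝 L) := by
  have hm := aestronglyMeasurable_of_ae_continuousAt hc
  have hc' : ∀ᵐ t, ContinuousAt (fun t => - h t) t := hc.mono fun t ht => ht.neg
  have h3 : W.Sub K fun t => - - h t := by simpa using h1
  have h4 : W.Sub K fun t => - unitAvg h t := by
    have := h2.unitAvg hK (hb.neg.intervalIntegrable hm.neg)
    rwa [show unitAvg (fun t => - h t) = fun t => - unitAvg h t from funext (unitAvg_neg h)] at this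
  obtain ⟨C, hC⟩ := hb.exists_lipschitz_unitAvg hm
  obtain ⟨L, hL⟩ := exists_tendsto_of_lipschitz hK (h1.unitAvg hK (hb.intervalIntegrable hm)) h4
    hb.unitAvg hC hW
  have hL' : Tendsto (unitAvg fun t => - h t) atTop (𝓝 (-L)) :=
    hL.neg.congr fun t => (unitAvg_neg h t).symm
  refine ⟨L, tendsto_order.2 ⟨fun a ha => ?_, fun a ha => ?_⟩⟩
  · exact (eventually_le_of_tendsto_unitAvg hK h2 h3 hb.neg hc' hW hL'
      (show 0 < (L - a) / 2 by linarith)).mono fun t ht => by linarith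
  · exact (eventually_le_of_tendsto_unitAvg hK h1 h2 hb hc hW hL
      (show 0 < (a - L) / 2 by linarith)).mono fun t ht => by linarith

end RenewalWeights

/-! ### The exponent and the translation to logarithmic coordinates -/

/-- The sum is continuous and strictly decreasing in `d`, from `m ≥ 2` at 0 to 0 at infinity. -/
theorem existsUnique_sum_rpow_eq_one {m : ℕ} (hm : 2 ≤ m) {γ : Fin m → ℝ}
    (hγ : ∀ i, 0 < γ i ∧ γ i < 1) : ∃! d : ℝ, 0 < d ∧ ∑ i, γ i ^ d = 1 := by
  have : NeZero m := ⟨by omega⟩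
  have hanti : StrictAnti fun d : ℝ => ∑ i, γ i ^ d := fun a b hab =>
    Finset.sum_lt_sum_of_nonempty Finset.univ_nonempty fun i _ =>
      Real.rpow_lt_rpow_of_exponent_gt (hγ i).1 (hγ i).2 hab
  have hcont : Continuous fun d : ℝ => ∑ i, γ i ^ d :=
    continuous_finsetSum _ fun i _ => Real.continuous_const_rpow (hγ i).1.ne'
  have hlim : Tendsto (fun d : ℝ => ∑ i, γ i ^ d) atTop (𝓝 (∑ _i : Fin m, 0)) :=
    tendsto_finsetSum _ fun i _ =>
      tendsto_rpow_atTop_of_base_lt_one (γ i) (by linarith [(hγ i).1]) (hγ i).2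
  rw [Finset.sum_const_zero] at hlim
  have hm' : (2 : ℝ) ≤ m := by exact_mod_cast hm
  obtain ⟨b, hb0, hb⟩ := ((eventually_ge_atTop (0 : ℝ)).and
    (hlim.eventually (gt_mem_nhds zero_lt_one))).exists
  obtain ⟨d, hd, hd1⟩ := intermediate_value_Icc' hb0 hcont.continuousOn
    (show (1 : ℝ) ∈ Set.Icc _ _ from ⟨hb.le, by simp; linarith⟩)
  refine ⟨d, ⟨lt_of_le_of_ne hd.1 ?_, hd1⟩, fun e he => hanti.injective (he.2.trans hd1.symm)⟩
  rintro rfl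
  simp at hd1
  linarith

/-- The renewal weights of a system of contraction ratios. -/
noncomputable def RenewalWeights.ofRatios {m : ℕ} (hm : 2 ≤ m) (γ : Fin m → ℝ)
    (hγ : ∀ i, 0 < γ i ∧ γ i < 1) {d : ℝ} (hd : 0 < d) (hsum : ∑ i, γ i ^ d = 1) :
    RenewalWeights (Fin m) where
  p i := γ i ^ d
  τ i := -Real.log (γ i)
  d := d
  p_pos i := Real.rpow_pos_of_pos (hγ i).1 d
  sum_p := hsum
  τ_pos i := neg_pos.2 (Real.log_neg (hγ i).1 (hγ i).2)
  d_pos := hd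
  two_le := by
    -- Each summand equals 1, so the sum is `m`.
    have : ∀ i, γ i ^ d * Real.exp (d * -Real.log (γ i)) = 1 := fun i => by
      rw [Real.rpow_def_of_pos (hγ i).1, ← Real.exp_add,
        show Real.log (γ i) * d + d * -Real.log (γ i) = 0 by ring, Real.exp_zero]
    simp only [this, Finset.sum_const, Finset.card_univ, Fintype.card_fin, nsmul_eq_mul, mul_one]
    exact_mod_cast hm

/-- `f` in logarithmic coordinates, normalised by the growth rate. -/
noncomputable def logProfile (d : ℝ) (f : ℝ → ℝ) (t : ℝ) : ℝ :=
  Real.exp (-(d * t)) * f (Real.exp (2 * t))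

theorem logProfile_log {d : ℝ} {f : ℝ → ℝ} {x : ℝ} (hx : 0 < x) :
    logProfile d f (Real.log x / 2) = f x * x ^ (-(d / 2)) := by
  rw [logProfile, mul_div_cancel₀ _ two_ne_zero, Real.exp_log hx, Real.rpow_def_of_pos hx,
    show -(d * (Real.log x / 2)) = Real.log x * -(d / 2) by ring, mul_comm]

theorem tendsto_log_div_two : Tendsto (fun x => Real.log x / 2) atTop atTop :=
  Real.tendsto_log_atTop.atTop_div_const two_pos

theorem ae_continuousAt_logProfile {d : ℝ} {f : ℝ → ℝ}
    (hf : ∀ᵐ x : ℝ ∂volume, 0 < x → ContinuousAt f x) :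
    ∀ᵐ t, ContinuousAt (logProfile d f) t := by
  have hexp : Continuous fun t : ℝ => Real.exp (2 * t) := by fun_prop
  rw [ae_iff] at hf ⊢
  -- The discontinuities of the profile lie in the image of a null set of positive points under `log
  -- x / 2`, which is differentiable there and so preserves nullity.
  refine measure_mono_null ?_ (addHaar_image_eq_zero_of_differentiableOn_of_addHaar_eq_zero
    (f := fun x => Real.log x / 2) volume ?_ hf)
  · intro t ht
    refine ⟨Real.exp (2 * t), ?_, by simp⟩
    simp only [Set.mem_ofPred_eq, Classical.not_imp]
    refine ⟨Real.exp_pos _, fun hcon => ht ?_⟩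
    have : ContinuousAt (fun t : ℝ => f (Real.exp (2 * t))) t :=
      ContinuousAt.comp (f := fun t : ℝ => Real.exp (2 * t)) hcon hexp.continuousAt
    exact ContinuousAt.mul (by fun_prop) this
  · intro x hx
    simp only [Set.mem_ofPred_eq, Classical.not_imp] at hx
    exact ((Real.differentiableAt_log hx.1.ne').div_const 2).differentiableWithinAt

section

variable {m : ℕ} {γ : Fin m → ℝ} (hm : 2 ≤ m) (hγ : ∀ i, 0 < γ i ∧ γ i < 1) {d : ℝ} (hd : 0 < d)
  (hsum : ∑ i, γ i ^ d = 1)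

theorem sub_logProfile {f g : ℝ → ℝ}
    (hfg : ∀ x : ℝ, 0 < x → f x = (∑ i, f (γ i ^ 2 * x)) + g x) {C : ℝ}
    (hg : ∀ x : ℝ, 0 < x → g x ≤ C) :
    (RenewalWeights.ofRatios hm γ hγ hd hsum).Sub C (logProfile d f) := by
  intro t
  have hx := Real.exp_pos (2 * t)
  have key : (RenewalWeights.ofRatios hm γ hγ hd hsum).avg (logProfile d f) t =
      Real.exp (-(d * t)) * ∑ i, f (γ i ^ 2 * Real.exp (2 * t)) := by
    rw [Finset.mul_sum]
    refine Finset.sum_congr rfl fun i _ => ?_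
    have hi := (hγ i).1
    simp only [RenewalWeights.ofRatios, logProfile]
    have e1 : Real.exp (2 * (t - -Real.log (γ i))) = γ i ^ 2 * Real.exp (2 * t) := by
      rw [show 2 * (t - -Real.log (γ i)) = Real.log (γ i) + Real.log (γ i) + 2 * t by ring,
        Real.exp_add, Real.exp_add, Real.exp_log hi, sq]
    rw [e1, ← mul_assoc, Real.rpow_def_of_pos hi, ← Real.exp_add]
    congr 2
    ring
  rw [key, logProfile, hfg _ hx, mul_add, mul_comm C]
  have : Real.exp (-(d * t)) * g (Real.exp (2 * t)) ≤ Real.exp (-(d * t)) * C :=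
    mul_le_mul_of_nonneg_left (hg _ hx) (Real.exp_pos _).le
  exact add_le_add_right this _

/-- Where `exp (2 t) < x₀` the profile is at most `C * exp (-d t)`, hence bounded on a window there;
the maximum principle extends the bound to the right. -/
theorem bddRight_logProfile {f : ℝ → ℝ} {K : ℝ} (hK : 0 ≤ K)
    (h1 : (RenewalWeights.ofRatios hm γ hγ hd hsum).Sub K (logProfile d f))
    (h2 : (RenewalWeights.ofRatios hm γ hγ hd hsum).Sub K fun t => - logProfile d f t)
    (hf : ∃ x₀ : ℝ, 0 < x₀ ∧ ∃ C : ℝ, ∀ x : ℝ, 0 < x → x < x₀ → |f x| ≤ C) :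
    BddRight (logProfile d f) := by
  obtain ⟨x₀, hx₀, C, hC⟩ := hf
  set W := RenewalWeights.ofRatios hm γ hγ hd hsum
  intro A
  set A' := min A (Real.log x₀ / 2)
  have hwin : ∀ t ∈ Set.univ, A' - W.span ≤ t → t < A' →
      |logProfile d f t - 0| ≤ W.decay (A' - W.span) * C := by
    intro t _ h3 h4
    have h5 : Real.exp (2 * t) < x₀ := by
      rw [← Real.lt_log_iff_exp_lt hx₀]
      linarith [min_le_right A (Real.log x₀ / 2)]
    rw [sub_zero, logProfile, abs_mul, abs_of_pos (Real.exp_pos _)]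
    exact mul_le_mul (W.decay_anti h3) (hC _ (Real.exp_pos _) h5) (abs_nonneg _)
      (W.decay_pos _).le
  refine ⟨W.decay (A' - W.span) * C + K * W.decay (A' - W.span), fun t ht => ?_⟩
  have := RenewalWeights.abs_sub_le_of_window hK h1 h2 (by simp) hwin (Set.mem_univ t)
    ((min_le_left _ _).trans ht)
  rwa [sub_zero] at this

theorem closure_range_ofRatios :
    AddSubgroup.closure (Set.range (RenewalWeights.ofRatios hm γ hγ hd hsum).τ) =
      AddSubgroup.closure (Set.range fun i => Real.log (γ i)) := by
  have : Set.range (RenewalWeights.ofRatios hm γ hγ hd hsum).τ =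
      -Set.range fun i => Real.log (γ i) := by
    rw [← Set.image_neg_eq_neg, ← Set.range_comp]
    rfl
  rw [this, AddSubgroup.closure_neg]

end

theorem mainTheorem5 (m : ℕ) (hm : 2 ≤ m) (γ : Fin m → ℝ) (hγ : ∀ i, 0 < γ i ∧ γ i < 1)
    (f g : ℝ → ℝ)
    (hfg : ∀ x : ℝ, 0 < x → f x = (∑ i, f (γ i ^ 2 * x)) + g x)
    (hg : ∃ C : ℝ, ∀ x : ℝ, 0 < x → |g x| ≤ C)
    (hf : ∃ x₀ : ℝ, 0 < x₀ ∧ ∃ C : ℝ, ∀ x : ℝ, 0 < x → x < x₀ → |f x| ≤ C) :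
    (∃! d : ℝ, 0 < d ∧ ∑ i, γ i ^ d = 1) ∧
    ∀ d : ℝ, 0 < d → ∑ i, γ i ^ d = 1 →
      -- lattice case
      (∀ T : ℝ, 0 < T →
        AddSubgroup.closure (Set.range fun i => Real.log (γ i)) = AddSubgroup.zmultiples T →
        ∃ G r : ℝ → ℝ, Function.Periodic G T ∧ Tendsto r atTop (𝓝 0) ∧
          ∀ x : ℝ, 0 < x → f x = x ^ (d / 2) * (G (Real.log x / 2) + r x)) ∧
      -- non-lattice case
      (Dense (AddSubgroup.closure (Set.range fun i => Real.log (γ i)) : Set ℝ) →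
        (∀ᵐ x : ℝ ∂volume, 0 < x → ContinuousAt f x) →
        ∃ L : ℝ, Tendsto (fun x : ℝ => f x * x ^ (-(d / 2))) atTop (𝓝 L)) := by
  refine ⟨existsUnique_sum_rpow_eq_one hm hγ, fun d hd hsum => ?_⟩
  obtain ⟨C, hC⟩ := hg
  have hC0 : 0 ≤ C := (abs_nonneg _).trans (hC 1 one_pos)
  have h1 := sub_logProfile hm hγ hd hsum hfg fun x hx => (abs_le.1 (hC x hx)).2
  have h2 : (RenewalWeights.ofRatios hm γ hγ hd hsum).Sub C fun t => - logProfile d f t := by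
    have := sub_logProfile hm hγ hd hsum (f := fun x => - f x) (g := fun x => - g x)
      (fun x hx => by rw [hfg x hx, Finset.sum_neg_distrib]; ring)
      fun x hx => neg_le.1 (abs_le.1 (hC x hx)).1
    rwa [show logProfile d (fun x => - f x) = fun t => - logProfile d f t from
      funext fun t => mul_neg _ _] at this
  have hb := bddRight_logProfile hm hγ hd hsum hC0 h1 h2 hf
  have hcl := closure_range_ofRatios hm hγ hd hsum
  refine ⟨fun T hT hlat => ?_, fun hdense hcont => ?_⟩
  · obtain ⟨G, hG, hlim⟩ := RenewalWeights.exists_periodic_of_lattice hC0 h1 h2 hb hT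
      (hcl.trans hlat)
    refine ⟨G, fun x => logProfile d f (Real.log x / 2) - G (Real.log x / 2), hG,
      hlim.comp tendsto_log_div_two, fun x hx => ?_⟩
    rw [add_sub_cancel, logProfile_log hx, Real.rpow_neg hx.le]
    have := (Real.rpow_pos_of_pos hx (d / 2)).ne'
    field_simp
  · obtain ⟨L, hL⟩ := RenewalWeights.exists_tendsto_of_dense hC0 h1 h2 hb
      (ae_continuousAt_logProfile hcont) (by rwa [hcl])
    refine ⟨L, (hL.comp tendsto_log_div_two).congr' ?_⟩
    exact (eventually_gt_atTop 0).mono fun x hx => logProfile_log hx
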